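/- **Conventions.** A graph is a one-dimensional CW complex (loops and multiple edges are allowed); a connected graph $X$ carries the path metric $d_X$ on all of its points in which every edge is a unit interval. $X$ is locally finite if every vertex abuts finitely many edges. A system of subgraphs of $X$ is a set $\mathcal H$ of (not necessarily connected) subgraphs of $X$; it is locally finite if every bounded subset of $X$ meets only finitely many members of $\mathcal H$. For $\varepsilon>0$ the filling $K_\varepsilon(X)$ is the 2-complex obtained from $X$ by attaching a 2-cell along every closed combinatorial loop of length at most $\varepsilon$. For a 2-complex $K$ with a system $\mathcal H$ of subgraphs of its 1-skeleton, the coned-off complex $K_{\mathcal H}$ is obtained by attaching to $K$, for every $Y\in\mathcal H$, a cone over $Y$ along its base $Y$, with one new vertex $v_Y$, one edge from $v$ to $v_Y$ for each vertex $v$ of $Y$, and one triangle for each edge of $Y$. A 2-complex is CHomP (cohomologically planar) if every compactly supported cellular 1-cocycle with coefficients in $\mathbb Z/2$ (i.e. one that is non-zero on only finitely many edges) is the coboundary of some 0-cochain. A connected graph $X$ is coarsely CHomP relative to $\mathcal H$ if there exists $\varepsilon>0$ such that $K_\varepsilon(X)_{\mathcal H}$ is CHomP. A $(\lambda,\lambda)$-quasi-isometry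 $\psi:X\to Y$ is a map with $\frac1\lambda d_X(x,y)-\lambda\le d_Y(\psi(x),\psi(y))\le\lambda d_X(x,y)+\lambda$ for all $x,y$ and $d_{\mathrm{Haus}}(Y,\psi(X))\le\lambda$. **Theorem.** Let $\Gamma_1,\Gamma_2$ be connected, locally finite graphs, and for $i=1,2$ let $\mathcal H_i$ be a locally finite system of subgraphs of $\Gamma_i$. Let $\lambda\ge1$ and let $\psi:\Gamma_1\to\Gamma_2$ be a continuous $(\lambda,\lambda)$-quasi-isometry. Let $a:\mathcal H_1\to\mathcal H_2$ be a bijection such that 1. $\psi(Y)\subseteq a(Y)$ for every $Y\in\mathcal H_1$; 2. for every $Z\in\mathcal H_2$, every connected component $U$ of $Z$ meets $\psi(a^{-1}(Z))$; 3. there is $r\ge0$ such that $d_{\mathrm{Haus}}(a(Y),\psi(Y))\le r$ for every $Y\in\mathcal H_1$. If $\Gamma_1$ is coarsely CHomP relative to $\mathcal H_1$, then $\Gamma_2$ is coarsely CHomP relative to $\mathcal H_2$. -/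

import Mathlib

/-! ### Graphs as one-dimensional CW complexes -/

/-- A graph, that is, a one-dimensional CW complex with `0`-cells `V` and `1`-cells `E`: each edge
is a copy of `[0, 1]` whose ends `0` and `1` are attached to `src e` and `tgt e`. Loops and
multiple edges are allowed; the choice of direction of an edge is only a parametrisation. -/
structure CWGraph (V E : Type*) where
  src : E → V
  tgt : E → V

namespace CWGraph

variable {V E : Type*}

/-- The simple graph in which distinct vertices are adjacent when some edge joins them. It has the
same connectivity and the same distance between vertices as `G`. -/
def adjGraph (G : CWGraph V E) : SimpleGraph V :=
  SimpleGraph.fromRel fun u v => ∃ e, G.src e = u ∧ G.tgt e = v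

/-- Connected (in particular non-empty). -/
def IsConnected (G : CWGraph V E) : Prop := G.adjGraph.Connected

/-- Every vertex abuts finitely many edges. -/
def IsLocallyFinite (G : CWGraph V E) : Prop :=
  ∀ v, {e | G.src e = v ∨ G.tgt e = v}.Finite

/-- The underlying set of the CW complex `G`: the disjoint union of the vertices and of the open
edges. -/
inductive Point (G : CWGraph V E) where
  | vertex (v : V) : Point G
  | inner (e : E) (t : Set.Ioo (0 : ℝ) 1) : Point G

open Classical in
/-- The characteristic map `[0, 1] → G` of the edge `e`. -/
noncomputable def edgeMap (G : CWGraph V E) (e : E) (t : Set.Icc (0 : ℝ) 1) : G.Point :=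
  if h0 : (t : ℝ) = 0 then .vertex (G.src e)
  else if h1 : (t : ℝ) = 1 then .vertex (G.tgt e)
  else .inner e ⟨t, lt_of_le_of_ne t.2.1 (Ne.symm h0), lt_of_le_of_ne t.2.2 h1⟩

/-- The CW topology: a set is open if and only if its preimage under the characteristic map of
every edge is open in `[0, 1]`. -/
noncomputable instance (G : CWGraph V E) : TopologicalSpace G.Point :=
  ⨆ e : E, TopologicalSpace.coinduced (G.edgeMap e) inferInstance

/-- `G.IsAt p u r`: one can go from the point `p` to the vertex `u` along a segment of length `r`
of the edge that contains `p`. -/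
def IsAt (G : CWGraph V E) : G.Point → V → ℝ → Prop
  | .vertex w, u, r => u = w ∧ r = 0
  | .inner e t, u, r => (u = G.src e ∧ r = t) ∨ (u = G.tgt e ∧ r = 1 - t)

/-- The lengths of the candidates for a shortest path from `p` to `q`, when each edge is a unit
interval: those through vertices, and the segment between `p` and `q` if they lie in the same open
edge. -/
def routeLengths (G : CWGraph V E) (p q : G.Point) : Set ℝ :=
  {l | ∃ u r v s, G.IsAt p u r ∧ G.IsAt q v s ∧ l = r + (G.adjGraph.dist u v : ℝ) + s} ∪
  {l | ∃ e t s, p = .inner e t ∧ q = .inner e s ∧ l = |(t : ℝ) - (s : ℝ)|}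

/-- The path metric on (all points of) a connected graph. -/
noncomputable instance (G : CWGraph V E) : Dist G.Point where
  dist p q := sInf (G.routeLengths p q)

/-- A (not necessarily connected) subgraph. -/
@[ext]
structure Subgraph (G : CWGraph V E) where
  verts : Set V
  edges : Set E
  src_mem : ∀ e ∈ edges, G.src e ∈ verts
  tgt_mem : ∀ e ∈ edges, G.tgt e ∈ verts

/-- The set of points of a subgraph. -/
def Subgraph.carrier {G : CWGraph V E} (Y : G.Subgraph) : Set G.Point :=
  {p | match p with
    | .vertex v => v ∈ Y.verts
    | .inner e _ => e ∈ Y.edges}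

/-- The initial vertex of an edge with a direction (`true`: from `src` to `tgt`). -/
def tail (G : CWGraph V E) (d : E × Bool) : V := if d.2 then G.src d.1 else G.tgt d.1

/-- The final vertex of an edge with a direction. -/
def head (G : CWGraph V E) (d : E × Bool) : V := if d.2 then G.tgt d.1 else G.src d.1

/-- `G.IsPath u p v`: the directed edges in the list `p` form a combinatorial path from `u` to
`v`. -/
def IsPath (G : CWGraph V E) : V → List (E × Bool) → V → Prop
  | u, [], v => u = v
  | u, d :: p, v => G.tail d = u ∧ G.IsPath (G.head d) p v

end CWGraph

/-! ### Coarse notions -/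

section Coarse

variable {X Y : Type*} [Dist X] [Dist Y]

/-- A subset of finite diameter. -/
def IsBoundedSubset (B : Set X) : Prop := ∃ R : ℝ, ∀ x ∈ B, ∀ y ∈ B, dist x y ≤ R

/-- The Hausdorff distance between two subsets, with values in `[0, ∞]`. -/
noncomputable def hausdorffDistance (A B : Set X) : ENNReal :=
  max (⨆ a ∈ A, ⨅ b ∈ B, ENNReal.ofReal (dist a b))
    (⨆ b ∈ B, ⨅ a ∈ A, ENNReal.ofReal (dist b a))

/-- `(lam, eps)`-quasi-isometries. -/
structure IsQuasiIsometry (lam eps : ℝ) (f : X → Y) : Prop where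
  lower : ∀ x y, 1 / lam * dist x y - eps ≤ dist (f x) (f y)
  upper : ∀ x y, dist (f x) (f y) ≤ lam * dist x y + eps
  coarselySurjective : hausdorffDistance Set.univ (Set.range f) ≤ ENNReal.ofReal eps

end Coarse

/-- A system of subgraphs is locally finite if every bounded set of points meets only finitely many
of its members. -/
def CWGraph.IsLocallyFiniteSystem {V E : Type*} {G : CWGraph V E} (H : Set G.Subgraph) : Prop :=
  ∀ B : Set G.Point, IsBoundedSubset B → {Y ∈ H | (Y.carrier ∩ B).Nonempty}.Finite

/-! ### Two-dimensional complexes -/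

/-- A two-dimensional complex: a graph with a `2`-cell for each `f : F`, attached along the closed
combinatorial path `bdry f` based at `base f`. -/
structure TwoComplex (V E F : Type*) where
  skel : CWGraph V E
  base : F → V
  bdry : F → List (E × Bool)
  isLoop : ∀ f, skel.IsPath (base f) (bdry f) (base f)

namespace TwoComplex

variable {V E F : Type*}

/-- The cellular coboundary of a `0`-cochain with coefficients in `ℤ/2`. -/
def d0 (K : TwoComplex V E F) (g : V → ZMod 2) : E → ZMod 2 :=
  fun e => g (K.skel.tgt e) - g (K.skel.src e)

/-- The cellular coboundary of a `1`-cochain with coefficients in `ℤ/2` (where directions do not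
matter). -/
def d1 (K : TwoComplex V E F) (z : E → ZMod 2) : F → ZMod 2 :=
  fun f => ((K.bdry f).map fun d => z d.1).sum

/-- Cohomological planarity: every compactly supported cellular `1`-cocycle (one that is non-zero
on finitely many edges only) is a coboundary, so that it vanishes in `H¹(K; ℤ/2)`. -/
def CHomP (K : TwoComplex V E F) : Prop :=
  ∀ z : E → ZMod 2, K.d1 z = 0 → (Function.support z).Finite → ∃ g : V → ZMod 2, K.d0 g = z

/-- The coned-off complex: a cone over each `Y ∈ H` is attached along its base `Y`. It has a new
vertex `v_Y` for each `Y ∈ H`, an edge from `v` to `v_Y` for each vertex `v` of `Y`, and a triangle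
spanned by `e` and `v_Y` for each edge `e` of `Y`. -/
def coneOff (K : TwoComplex V E F) (H : Set K.skel.Subgraph) :
    TwoComplex (V ⊕ H) (E ⊕ (Σ Y : H, Y.1.verts)) (F ⊕ (Σ Y : H, Y.1.edges)) where
  skel :=
    { src := Sum.elim (fun e => .inl (K.skel.src e)) (fun c => .inl c.2.1)
      tgt := Sum.elim (fun e => .inl (K.skel.tgt e)) (fun c => .inr c.1) }
  base := Sum.elim (fun f => .inl (K.base f)) (fun c => .inl (K.skel.src c.2.1))
  bdry := Sum.elim
    (fun f => (K.bdry f).map fun d => (.inl d.1, d.2))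
    (fun c =>
      [(.inl c.2.1, true),
       (.inr ⟨c.1, ⟨K.skel.tgt c.2.1, c.1.1.tgt_mem _ c.2.2⟩⟩, true),
       (.inr ⟨c.1, ⟨K.skel.src c.2.1, c.1.1.src_mem _ c.2.2⟩⟩, false)])
  isLoop := by
    rintro (f | c)
    · have key : ∀ (p : List (E × Bool)) (u v : V), K.skel.IsPath u p v →
          CWGraph.IsPath
            { src := Sum.elim (fun e => .inl (K.skel.src e)) (fun c => .inl c.2.1)
              tgt := Sum.elim (fun e => .inl (K.skel.tgt e)) (fun c => .inr c.1) :
              CWGraph (V ⊕ H) (E ⊕ (Σ Y : H, Y.1.verts)) }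
            (.inl u) (p.map fun d => (.inl d.1, d.2)) (.inl v) := by
        intro p
        induction p with
        | nil => intro u v h; exact congrArg Sum.inl h
        | cons d p ih =>
          intro u v h
          obtain ⟨h1, h2⟩ := h
          obtain ⟨e, b⟩ := d
          cases b
          · exact ⟨congrArg Sum.inl h1, ih _ _ h2⟩
          · exact ⟨congrArg Sum.inl h1, ih _ _ h2⟩
      exact key _ _ _ (K.isLoop f)
    · exact ⟨rfl, rfl, rfl, rfl⟩

end TwoComplex

namespace CWGraph

variable {V E : Type*}

/-- The `ε`-filling `K_ε(G)`: a `2`-cell is attached along every closed combinatorial path of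
length at most `ε`. -/
def filling (G : CWGraph V E) (ε : ℝ) :
    TwoComplex V E {l : V × List (E × Bool) // G.IsPath l.1 l.2 l.1 ∧ (l.2.length : ℝ) ≤ ε} where
  skel := G
  base l := l.1.1
  bdry l := l.1.2
  isLoop l := l.2.1

/-- `G` is coarsely CHomP relative to the system of subgraphs `H`. -/
def CoarselyCHomPRel (G : CWGraph V E) (H : Set G.Subgraph) : Prop :=
  ∃ ε : ℝ, 0 < ε ∧ ((G.filling ε).coneOff H).CHomP

end CWGraph

/-! A compactly supported cocycle on the coned-off filling of `Γ₂` is pulled back to `Γ₁`, where it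
has a primitive, and the primitive is pushed forward along a quasi-inverse. If the filling constant
of `Γ₂` is large enough, every loop arising in the comparison is filled, so integrals of the cocycle
along short paths depend only on the endpoints. The support stays finite because quasi-isometries of
locally finite graphs are proper (`finite_support_pullback`).

The cones need two facts about connectedness. The pullback satisfies the triangle relation for an
edge of `Y` because continuity makes the image of that edge a connected subset of `a Y`, of bounded
size. The pushed-forward primitive is correct on all of `Z` because its defect is constant on each
component of `Z`, and each component meets the image of `a.symm Z`, where the defect vanishes. Both
rest on `Subgraph.root_iff_of_isPreconnected`, which turns topological connectedness into
propagation along edges; `CoarselyCHomPRel.transfer` is then purely combinatorial. -/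

namespace CWGraph

/-! ### Combinatorial paths, integration of cochains and finiteness of balls -/

section Paths

variable {V E : Type*} {G : CWGraph V E}

/-- The value of a `1`-cochain on a combinatorial path. -/
def pathSum (z : E → ZMod 2) (p : List (E × Bool)) : ZMod 2 := (p.map fun d => z d.1).sum

@[simp] lemma pathSum_nil (z : E → ZMod 2) : pathSum z [] = 0 := rfl

@[simp] lemma pathSum_cons (z : E → ZMod 2) (d : E × Bool) (p : List (E × Bool)) :
    pathSum z (d :: p) = z d.1 + pathSum z p := by
  simp [pathSum]

@[simp] lemma pathSum_append (z : E → ZMod 2) (p q : List (E × Bool)) :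
    pathSum z (p ++ q) = pathSum z p + pathSum z q := by
  simp [pathSum]

/-- The reversed combinatorial path. -/
def reversePath (p : List (E × Bool)) : List (E × Bool) := (p.map fun d => (d.1, !d.2)).reverse

@[simp] lemma length_reversePath (p : List (E × Bool)) : (reversePath p).length = p.length := by
  simp [reversePath]

@[simp] lemma pathSum_reversePath (z : E → ZMod 2) (p : List (E × Bool)) :
    pathSum z (reversePath p) = pathSum z p := by
  simp [pathSum, reversePath, List.sum_reverse, Function.comp_def]

lemma IsPath.append : ∀ {p q : List (E × Bool)} {u v w : V},
    G.IsPath u p v → G.IsPath v q w → G.IsPath u (p ++ q) w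
  | [], _, _, _, _, h, h' => by
    obtain rfl : _ = _ := h
    exact h'
  | _ :: _, _, _, _, _, h, h' => ⟨h.1, IsPath.append h.2 h'⟩

lemma tail_not (d : E × Bool) : G.tail (d.1, !d.2) = G.head d := by
  rcases d with ⟨e, _ | _⟩ <;> rfl

lemma head_not (d : E × Bool) : G.head (d.1, !d.2) = G.tail d := by
  rcases d with ⟨e, _ | _⟩ <;> rfl

lemma IsPath.reverse : ∀ {p : List (E × Bool)} {u v : V},
    G.IsPath u p v → G.IsPath v (reversePath p) u
  | [], _, _, h => Eq.symm h
  | d :: p, u, v, h => by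
    have h1 : G.IsPath (G.head d) [(d.1, !d.2)] u := ⟨tail_not d, (head_not d).trans h.1⟩
    simpa [reversePath] using (IsPath.reverse h.2).append h1

lemma isPath_edge (e : E) : G.IsPath (G.src e) [(e, true)] (G.tgt e) := ⟨rfl, rfl⟩

/-- A cochain that vanishes on short closed paths takes the same value on short paths with the same
ends. -/
lemma pathSum_eq_of_isPath {z : E → ZMod 2} {M : ℕ}
    (hz : ∀ v p, G.IsPath v p v → p.length ≤ M → pathSum z p = 0)
    {u v : V} {p q : List (E × Bool)} (hp : G.IsPath u p v) (hq : G.IsPath u q v)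
    (hM : p.length + q.length ≤ M) : pathSum z p = pathSum z q := by
  have h := hz u (p ++ reversePath q) (hp.append hq.reverse) (by simpa using hM)
  rw [pathSum_append, pathSum_reversePath] at h
  exact CharTwo.add_eq_zero.mp h

/-- The sum telescopes; signs and edge directions disappear modulo 2. -/
lemma pathSum_coboundary (g : V → ZMod 2) {z : E → ZMod 2}
    (hg : ∀ e, g (G.tgt e) - g (G.src e) = z e) :
    ∀ {p : List (E × Bool)} {u v : V}, G.IsPath u p v → pathSum z p = g u + g v
  | [], u, v, h => by
    obtain rfl : u = v := h
    simp [CharTwo.add_self_eq_zero]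
  | d :: p, u, v, h => by
    rw [pathSum_cons, pathSum_coboundary g hg h.2, ← hg, ← h.1, CharTwo.sub_eq_add]
    rcases d with ⟨e, _ | _⟩ <;> simp only [tail, head, if_true, if_false, Bool.false_eq_true]
    · generalize g (G.src e) = x, g (G.tgt e) = y, g v = t
      revert x y t; decide
    · generalize g (G.src e) = x, g (G.tgt e) = y, g v = t
      revert x y t; decide

lemma dist_src_tgt_le (e : E) : G.adjGraph.dist (G.src e) (G.tgt e) ≤ 1 := by
  by_cases h : G.src e = G.tgt e
  · simp [h]
  · exact (SimpleGraph.dist_eq_one_iff_adj.mpr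
      ((SimpleGraph.fromRel_adj _ _ _).mpr ⟨h, Or.inl ⟨e, rfl, rfl⟩⟩)).le

lemma dist_tail_head_le (d : E × Bool) : G.adjGraph.dist (G.tail d) (G.head d) ≤ 1 := by
  rcases d with ⟨e, _ | _⟩
  · rw [SimpleGraph.dist_comm]
    exact dist_src_tgt_le e
  · exact dist_src_tgt_le e

lemma exists_isPath_of_walk {u v : V} (w : G.adjGraph.Walk u v) :
    ∃ p, G.IsPath u p v ∧ p.length = w.length := by
  induction w with
  | nil => exact ⟨[], rfl, rfl⟩
  | cons h w ih =>
    obtain ⟨p, hp, hl⟩ := ih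
    obtain ⟨-, ⟨e, rfl, rfl⟩ | ⟨e, rfl, rfl⟩⟩ := (SimpleGraph.fromRel_adj _ _ _).mp h
    · exact ⟨(e, true) :: p, ⟨rfl, hp⟩, by simp [hl]⟩
    · exact ⟨(e, false) :: p, ⟨rfl, hp⟩, by simp [hl]⟩

lemma IsConnected.exists_geodesic (hG : G.IsConnected) (u v : V) :
    ∃ p, G.IsPath u p v ∧ p.length = G.adjGraph.dist u v := by
  obtain ⟨w, hw⟩ := SimpleGraph.Connected.exists_walk_length_eq_dist hG u v
  obtain ⟨p, hp, hl⟩ := exists_isPath_of_walk w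
  exact ⟨p, hp, hl.trans hw⟩

/-- A shortest path. -/
noncomputable def geodesic (hG : G.IsConnected) (u v : V) : List (E × Bool) :=
  (hG.exists_geodesic u v).choose

lemma isPath_geodesic (hG : G.IsConnected) (u v : V) : G.IsPath u (geodesic hG u v) v :=
  (hG.exists_geodesic u v).choose_spec.1

lemma length_geodesic (hG : G.IsConnected) (u v : V) :
    (geodesic hG u v).length = G.adjGraph.dist u v :=
  (hG.exists_geodesic u v).choose_spec.2

/-- A non-zero sum has a non-zero term. This locates the support of a pulled-back cochain. -/
lemma exists_support_near (hG : G.IsConnected) {z : E → ZMod 2} :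
    ∀ {p : List (E × Bool)} {u v : V}, G.IsPath u p v → pathSum z p ≠ 0 →
      ∃ e, z e ≠ 0 ∧ G.adjGraph.dist u (G.src e) ≤ p.length
  | [], _, _, _, h0 => absurd rfl h0
  | d :: p, u, v, h, h0 => by
    obtain ⟨rfl, h⟩ := h
    have h1 := G.dist_tail_head_le d
    by_cases hd : z d.1 = 0
    · rw [pathSum_cons, hd, zero_add] at h0
      obtain ⟨e, he, hl⟩ := exists_support_near hG h h0
      refine ⟨e, he, ?_⟩
      have := SimpleGraph.Connected.dist_triangle hG (u := G.tail d) (v := G.head d) (w := G.src e)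
      simp only [List.length_cons]
      omega
    · refine ⟨d.1, hd, ?_⟩
      simp only [List.length_cons]
      rcases d with ⟨e, _ | _⟩
      · exact h1.trans (by omega)
      · simp [tail]

lemma IsLocallyFinite.finite_paths (hG : G.IsLocallyFinite) (n : ℕ) (u : V) :
    {v | ∃ p, G.IsPath u p v ∧ p.length = n}.Finite := by
  induction n generalizing u with
  | zero =>
    refine (Set.finite_singleton u).subset ?_
    rintro v ⟨p, hp, hl⟩
    obtain rfl := List.length_eq_zero_iff.mp hl
    exact Eq.symm hp
  | succ n ih =>
    have hd : {d : E × Bool | G.tail d = u}.Finite := by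
      refine ((hG u).prod Set.finite_univ).subset ?_
      rintro ⟨e, _ | _⟩ h
      · exact ⟨Or.inr h, trivial⟩
      · exact ⟨Or.inl h, trivial⟩
    refine (hd.biUnion fun d _ => ih (G.head d)).subset ?_
    rintro v ⟨_ | ⟨d, p⟩, hp, hl⟩
    · simp at hl
    · exact Set.mem_biUnion (show d ∈ {d | G.tail d = u} from hp.1) ⟨p, hp.2, by simpa using hl⟩

lemma finite_ball (hG : G.IsConnected) (hG' : G.IsLocallyFinite) (u : V) (R : ℕ) :
    {v | G.adjGraph.dist u v ≤ R}.Finite := by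
  refine ((Set.finite_Iic R).biUnion fun n _ => hG'.finite_paths n u).subset fun v hv => ?_
  exact Set.mem_biUnion (show G.adjGraph.dist u v ∈ Set.Iic R from hv)
    (hG.exists_geodesic u v)

end Paths

/-! ### Connectedness in the CW topology, read off on vertices -/

section Topology

variable {V E : Type*} {G : CWGraph V E}

/-- Under each characteristic map the preimage is either the whole interval or a subset of its two
ends. -/
lemma Subgraph.isClosed_carrier (Y : G.Subgraph) : IsClosed Y.carrier := by
  refine isClosed_iSup_iff.mpr fun e => isClosed_coinduced.mpr ?_
  by_cases he : e ∈ Y.edges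
  · convert isClosed_univ
    refine Set.eq_univ_of_forall fun t => ?_
    simp only [Set.mem_preimage, edgeMap]
    split_ifs
    · exact Y.src_mem e he
    · exact Y.tgt_mem e he
    · exact he
  · refine Set.Finite.isClosed ((Set.toFinite {0, 1}).subset fun t ht => ?_)
    simp only [Set.mem_preimage, edgeMap] at ht
    split_ifs at ht with h0 h1
    · exact Or.inl (Subtype.ext h0)
    · exact Or.inr (Subtype.ext h1)
    · exact absurd ht he

lemma continuous_edgeMap (e : E) : Continuous (G.edgeMap e) :=
  continuous_iff_coinduced_le.mpr
    (le_iSup (fun e : E => TopologicalSpace.coinduced (G.edgeMap e) inferInstance) e)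

/-- The vertex of a point: the point itself, or the source of the open edge that contains it. -/
def Point.root : G.Point → V
  | .vertex v => v
  | .inner e _ => G.src e

@[simp] lemma root_vertex (v : V) : (Point.vertex v : G.Point).root = v := rfl

@[simp] lemma root_inner (e : E) (t) : (Point.inner e t : G.Point).root = G.src e := rfl

lemma Subgraph.root_mem {Y : G.Subgraph} {p : G.Point} (hp : p ∈ Y.carrier) : p.root ∈ Y.verts := by
  cases p with
  | vertex v => exact hp
  | inner e t => exact Y.src_mem e hp

/-- A property of vertices that is constant along the edges of a subgraph does not separate a
connected subset of the subgraph. -/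
lemma Subgraph.root_iff_of_isPreconnected (W : G.Subgraph) {C : Set G.Point}
    (hC : IsPreconnected C) (hCW : C ⊆ W.carrier) (χ : V → Prop)
    (hχ : ∀ e ∈ W.edges, (χ (G.src e) ↔ χ (G.tgt e))) {p q : G.Point} (hp : p ∈ C) (hq : q ∈ C)
    (h : χ p.root) : χ q.root := by
  by_contra hn
  -- As `χ` is constant along edges, `W` splits into two disjoint subgraphs, both closed, so `C`
  -- cannot meet both.
  let sub (χ : V → Prop) (hχ : ∀ e ∈ W.edges, (χ (G.src e) ↔ χ (G.tgt e))) : G.Subgraph :=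
    { verts := {v | v ∈ W.verts ∧ χ v}
      edges := {e | e ∈ W.edges ∧ χ (G.src e)}
      src_mem := fun e he => ⟨W.src_mem e he.1, he.2⟩
      tgt_mem := fun e he => ⟨W.tgt_mem e he.1, (hχ e he.1).mp he.2⟩ }
  have mem (χ) (hχ) (x : G.Point) : x ∈ (sub χ hχ).carrier ↔ x ∈ W.carrier ∧ χ x.root := by
    cases x <;> rfl
  have hχ' : ∀ e ∈ W.edges, (¬ χ (G.src e) ↔ ¬ χ (G.tgt e)) := fun e he => not_congr (hχ e he)
  let A := sub χ hχ
  let B := sub (fun v => ¬ χ v) hχ'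
  obtain ⟨x, -, hxA, hxB⟩ := isPreconnected_closed_iff.mp hC A.carrier B.carrier
    A.isClosed_carrier B.isClosed_carrier
    (fun x hx => by
      by_cases hx' : χ x.root
      · exact Or.inl ((mem χ hχ x).mpr ⟨hCW hx, hx'⟩)
      · exact Or.inr ((mem _ hχ' x).mpr ⟨hCW hx, hx'⟩))
    ⟨p, hp, (mem χ hχ p).mpr ⟨hCW hp, h⟩⟩ ⟨q, hq, (mem _ hχ' q).mpr ⟨hCW hq, hn⟩⟩
  exact ((mem _ hχ' x).mp hxB).2 ((mem χ hχ x).mp hxA).2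

/-- The smallest subgraph that contains a given set of points. -/
def hull (C : Set G.Point) : G.Subgraph where
  verts := {v | .vertex v ∈ C ∨ ∃ e t, .inner e t ∈ C ∧ (v = G.src e ∨ v = G.tgt e)}
  edges := {e | ∃ t, .inner e t ∈ C}
  src_mem := fun e ⟨t, ht⟩ => Or.inr ⟨e, t, ht, Or.inl rfl⟩
  tgt_mem := fun e ⟨t, ht⟩ => Or.inr ⟨e, t, ht, Or.inr rfl⟩

lemma subset_carrier_hull (C : Set G.Point) : C ⊆ (hull C).carrier := by
  rintro (v | ⟨e, t⟩) h
  · exact Or.inl h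
  · exact ⟨t, h⟩

end Topology

/-! ### Comparison of the path metric with the vertex metric -/

section Metric

variable {V E : Type*} {G : CWGraph V E}

lemma IsAt.nonneg {p : G.Point} {u : V} {r : ℝ} (h : G.IsAt p u r) : 0 ≤ r := by
  cases p with
  | vertex v => exact h.2.ge
  | inner e t =>
    obtain ⟨-, rfl⟩ | ⟨-, rfl⟩ := h
    · exact t.2.1.le
    · exact sub_nonneg.mpr t.2.2.le

lemma IsAt.dist_root_le {p : G.Point} {u : V} {r : ℝ} (h : G.IsAt p u r) :
    G.adjGraph.dist p.root u ≤ 1 := by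
  cases p with
  | vertex v => simp [h.1]
  | inner e t =>
    obtain ⟨rfl, -⟩ | ⟨rfl, -⟩ := h
    · simp
    · exact dist_src_tgt_le e

lemma exists_isAt_root (p : G.Point) : ∃ r ≤ 1, G.IsAt p p.root r := by
  cases p with
  | vertex v => exact ⟨0, zero_le_one, rfl, rfl⟩
  | inner e t => exact ⟨t, t.2.2.le, Or.inl ⟨rfl, rfl⟩⟩

lemma dist_le_dist_root (p q : G.Point) : dist p q ≤ G.adjGraph.dist p.root q.root + 2 := by
  obtain ⟨r, hr, hp⟩ := exists_isAt_root p
  obtain ⟨s, hs, hq⟩ := exists_isAt_root q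
  have hmem : r + G.adjGraph.dist p.root q.root + s ∈ G.routeLengths p q :=
    Or.inl ⟨_, r, _, s, hp, hq, rfl⟩
  refine (csInf_le ⟨0, ?_⟩ hmem).trans (by linarith)
  rintro l (⟨u, r, v, s, hu, hv, rfl⟩ | ⟨e, t, s, -, -, rfl⟩)
  · have := hu.nonneg
    have := hv.nonneg
    positivity
  · positivity

/-- A route through vertices leaves and arrives at vertices within distance 1 of the two roots;
points of the same open edge have the same root. -/
lemma dist_root_le_dist (hG : G.IsConnected) (p q : G.Point) :
    (G.adjGraph.dist p.root q.root : ℝ) ≤ dist p q + 2 := by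
  obtain ⟨r, hr, hp⟩ := exists_isAt_root p
  obtain ⟨s, hs, hq⟩ := exists_isAt_root q
  rw [← sub_le_iff_le_add]
  refine le_csInf ⟨_, Or.inl ⟨_, r, _, s, hp, hq, rfl⟩⟩ ?_
  rintro l (⟨u, r, v, s, hu, hv, rfl⟩ | ⟨e, t, s, rfl, rfl, rfl⟩)
  · have h1 := hu.nonneg
    have h2 := hv.nonneg
    have h3 := hu.dist_root_le
    have h4 := hv.dist_root_le
    rw [SimpleGraph.dist_comm] at h4
    have h5 := SimpleGraph.Connected.dist_triangle hG (u := p.root) (v := u) (w := q.root)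
    have h6 := SimpleGraph.Connected.dist_triangle hG (u := u) (v := v) (w := q.root)
    have h7 : G.adjGraph.dist p.root q.root ≤ G.adjGraph.dist u v + 2 := by omega
    have h8 : (G.adjGraph.dist p.root q.root : ℝ) ≤ G.adjGraph.dist u v + 2 := by exact_mod_cast h7
    linarith
  · have := abs_nonneg ((t : ℝ) - s)
    simp only [root_inner, SimpleGraph.dist_self, Nat.cast_zero]
    linarith

end Metric

/-- The infimum need not be attained, hence the strictly larger `s`. -/
lemma exists_dist_lt_of_hausdorffDistance_le {X : Type*} [Dist X] {A B : Set X} {r s : ℝ}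
    (h : hausdorffDistance A B ≤ ENNReal.ofReal r) (hs : 0 < s) (hrs : r < s) {x : X}
    (hx : x ∈ A) : ∃ y ∈ B, dist x y < s := by
  have h1 : ⨅ b ∈ B, ENNReal.ofReal (dist x b) < ENNReal.ofReal s :=
    ((le_iSup₂ (f := fun a (_ : a ∈ A) => ⨅ b ∈ B, ENNReal.ofReal (dist a b)) x hx).trans
      ((le_max_left _ _).trans h)).trans_lt ((ENNReal.ofReal_lt_ofReal_iff hs).mpr hrs)
  obtain ⟨y, h2⟩ := iInf_lt_iff.mp h1
  obtain ⟨hy, h3⟩ := iInf_lt_iff.mp h2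
  exact ⟨y, hy, (ENNReal.ofReal_lt_ofReal_iff hs).mp h3⟩

/-! ### Cocycles on the coned-off filling -/

section ConeOff

variable {V E : Type*} {G : CWGraph V E}

/-- `1`-cocycles of the coned-off filling: a cochain `z` on the edges of the graph and a cochain `c`
on the edges of the cones. -/
structure IsConeCocycle (H : Set G.Subgraph) (ε : ℝ) (z : E → ZMod 2)
    (c : (Σ Y : H, Y.1.verts) → ZMod 2) : Prop where
  loop : ∀ v p, G.IsPath v p v → (p.length : ℝ) ≤ ε → pathSum z p = 0
  triangle : ∀ (Y : H) e (he : e ∈ Y.1.edges),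
    z e = c ⟨Y, G.src e, Y.1.src_mem e he⟩ + c ⟨Y, G.tgt e, Y.1.tgt_mem e he⟩

/-- The cells are disjoint unions, so a cochain is a pair; modulo 2 the boundary of a cone triangle
gives the symmetric relation `triangle`. -/
lemma cHomP_coneOff_iff (H : Set G.Subgraph) (ε : ℝ) :
    ((G.filling ε).coneOff H).CHomP ↔
      ∀ z c, IsConeCocycle H ε z c → (Function.support z).Finite → (Function.support c).Finite →
        ∃ (g : V → ZMod 2) (k : H → ZMod 2), (∀ e, g (G.tgt e) - g (G.src e) = z e) ∧
          ∀ (Y : H) (v : Y.1.verts), k Y - g v = c ⟨Y, v⟩ := by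
  constructor
  · intro h z c hzc hz hc
    have key := h (Sum.elim z c) ?_ ?_
    · obtain ⟨g, hg⟩ := key
      exact ⟨fun v => g (.inl v), fun Y => g (.inr Y), fun e => congrFun hg (.inl e),
        fun Y v => congrFun hg (.inr ⟨Y, v⟩)⟩
    · funext f
      rcases f with f | f
      · have := hzc.loop f.1.1 f.1.2 f.2.1 f.2.2
        simpa [TwoComplex.d1, TwoComplex.coneOff, filling, pathSum, Function.comp_def] using this
      · have := hzc.triangle f.1 f.2.1 f.2.2
        simp only [TwoComplex.d1, TwoComplex.coneOff, Sum.elim_inr, List.map_cons, List.map_nil,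
          List.sum_cons, List.sum_nil, Pi.zero_apply, add_zero]
        exact CharTwo.add_eq_zero.mpr (this.trans (add_comm _ _))
    · refine ((hz.image Sum.inl).union (hc.image Sum.inr)).subset ?_
      rintro (e | e) he
      · exact Or.inl ⟨e, he, rfl⟩
      · exact Or.inr ⟨e, he, rfl⟩
  · intro h z hz hfin
    have key := h (fun e => z (.inl e)) (fun e => z (.inr e)) ⟨?_, ?_⟩
      (hfin.preimage Sum.inl_injective.injOn) (hfin.preimage Sum.inr_injective.injOn)
    · obtain ⟨g, k, hg, hk⟩ := key
      refine ⟨Sum.elim g k, ?_⟩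
      funext e
      rcases e with e | e
      · exact hg e
      · exact hk e.1 e.2
    · intro v p hp hl
      have := congrFun hz (.inl ⟨(v, p), hp, hl⟩)
      simpa [TwoComplex.d1, TwoComplex.coneOff, filling, pathSum, Function.comp_def] using this
    · intro Y e he
      have := congrFun hz (.inr ⟨Y, e, he⟩)
      simp only [TwoComplex.d1, TwoComplex.coneOff, Sum.elim_inr, List.map_cons, List.map_nil,
          List.sum_cons, List.sum_nil, Pi.zero_apply, add_zero] at this
      exact (CharTwo.add_eq_zero.mp this).trans (add_comm _ _)

end ConeOff

/-! ### Pulling cocycles back and pushing primitives forward -/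

section Transfer

variable {V₁ E₁ V₂ E₂ : Type*} {Γ₁ : CWGraph V₁ E₁} {Γ₂ : CWGraph V₂ E₂}

/-- The pullback of a `1`-cochain along a map of vertices, evaluated on shortest paths. -/
noncomputable def pullback (Γ₁ : CWGraph V₁ E₁) (h₂ : Γ₂.IsConnected) (f : V₁ → V₂)
    (z : E₂ → ZMod 2) : E₁ → ZMod 2 :=
  fun e => pathSum z (geodesic h₂ (f (Γ₁.src e)) (f (Γ₁.tgt e)))

/-- Each edge is replaced by the geodesic that defines the pullback, reversed if the edge is
traversed backwards. -/
lemma exists_image_path (h₂ : Γ₂.IsConnected) {f : V₁ → V₂} {N : ℕ}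
    (hf : ∀ e, Γ₂.adjGraph.dist (f (Γ₁.src e)) (f (Γ₁.tgt e)) ≤ N) (z : E₂ → ZMod 2) :
    ∀ {p : List (E₁ × Bool)} {u v : V₁}, Γ₁.IsPath u p v →
      ∃ q, Γ₂.IsPath (f u) q (f v) ∧ q.length ≤ N * p.length ∧
        pathSum z q = pathSum (pullback Γ₁ h₂ f z) p
  | [], u, v, h => ⟨[], congrArg f h, by simp, rfl⟩
  | d :: p, u, v, h => by
    obtain ⟨rfl, h⟩ := h
    obtain ⟨q, hq, hl, hs⟩ := exists_image_path h₂ hf z h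
    obtain ⟨q', hq', hl', hs'⟩ : ∃ q', Γ₂.IsPath (f (Γ₁.tail d)) q' (f (Γ₁.head d)) ∧
        q'.length ≤ N ∧ pathSum z q' = pullback Γ₁ h₂ f z d.1 := by
      rcases d with ⟨e, _ | _⟩
      · exact ⟨_, (isPath_geodesic h₂ _ _).reverse,
          by rw [length_reversePath, length_geodesic]; exact hf e, pathSum_reversePath _ _⟩
      · exact ⟨_, isPath_geodesic h₂ _ _, by rw [length_geodesic]; exact hf e, rfl⟩
    refine ⟨q' ++ q, hq'.append hq, ?_, by simp [hs, hs']⟩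
    simp only [List.length_append, List.length_cons]
    linarith

/-- The lower bound on `f` puts the preimage inside one ball of `Γ₁`. -/
lemma finite_preimage_ball (h₁ : Γ₁.IsConnected) (hfin₁ : Γ₁.IsLocallyFinite)
    (h₂ : Γ₂.IsConnected) {f : V₁ → V₂} {N : ℕ}
    (hf : ∀ u v, Γ₁.adjGraph.dist u v ≤ N * Γ₂.adjGraph.dist (f u) (f v) + N) (s : V₂) (R : ℕ) :
    {u | Γ₂.adjGraph.dist (f u) s ≤ R}.Finite := by
  rcases Set.eq_empty_or_nonempty {u | Γ₂.adjGraph.dist (f u) s ≤ R} with h | ⟨u, hu⟩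
  · rw [h]
    exact Set.finite_empty
  · refine (finite_ball h₁ hfin₁ u (N * (R + R) + N)).subset fun v hv => ?_
    refine (hf u v).trans (Nat.add_le_add_right (Nat.mul_le_mul_left _ ?_) _)
    have h3 := SimpleGraph.Connected.dist_triangle h₂ (u := f u) (v := s) (w := f v)
    rw [SimpleGraph.dist_comm (u := s)] at h3
    exact h3.trans (add_le_add hu hv)

lemma finite_support_pullback (h₁ : Γ₁.IsConnected) (hfin₁ : Γ₁.IsLocallyFinite)
    (h₂ : Γ₂.IsConnected) {f : V₁ → V₂} {N : ℕ}
    (hup : ∀ e, Γ₂.adjGraph.dist (f (Γ₁.src e)) (f (Γ₁.tgt e)) ≤ N)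
    (hlow : ∀ u v, Γ₁.adjGraph.dist u v ≤ N * Γ₂.adjGraph.dist (f u) (f v) + N)
    {z : E₂ → ZMod 2} (hz : (Function.support z).Finite) :
    (Function.support (pullback Γ₁ h₂ f z)).Finite := by
  refine ((hz.biUnion fun e _ => finite_preimage_ball h₁ hfin₁ h₂ hlow (Γ₂.src e) N).biUnion
    fun u _ => hfin₁ u).subset fun e he => ?_
  obtain ⟨e', he', hd⟩ := exists_support_near h₂ (isPath_geodesic h₂ _ _) he
  rw [length_geodesic] at hd
  exact Set.mem_biUnion (Set.mem_biUnion (show e' ∈ Function.support z from he')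
    (hd.trans (hup e))) (Or.inl rfl)

/-- Coarse cohomological planarity is transferred along a map of vertices that is a quasi-isometry
compatible with the systems of subgraphs. -/
theorem CoarselyCHomPRel.transfer (h₁ : Γ₁.IsConnected) (hfin₁ : Γ₁.IsLocallyFinite)
    (h₂ : Γ₂.IsConnected) {H₁ : Set Γ₁.Subgraph} {H₂ : Set Γ₂.Subgraph} (a : H₁ ≃ H₂)
    (f : V₁ → V₂) (φ : V₂ → V₁) (N : ℕ)
    (hup : ∀ e, Γ₂.adjGraph.dist (f (Γ₁.src e)) (f (Γ₁.tgt e)) ≤ N)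
    (hlow : ∀ u v, Γ₁.adjGraph.dist u v ≤ N * Γ₂.adjGraph.dist (f u) (f v) + N)
    (hφ : ∀ w, Γ₂.adjGraph.dist (f (φ w)) w ≤ N)
    (hmem : ∀ Y : H₁, ∀ v ∈ Y.1.verts, f v ∈ (a Y).1.verts)
    (hedge : ∀ Y : H₁, ∀ e ∈ Y.1.edges, ∃ W : Γ₂.Subgraph, W.edges ⊆ (a Y).1.edges ∧
      (∀ v ∈ W.verts, Γ₂.adjGraph.dist (f (Γ₁.src e)) v ≤ N) ∧
      ∀ χ : V₂ → Prop, (∀ e ∈ W.edges, (χ (Γ₂.src e) ↔ χ (Γ₂.tgt e))) →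
        χ (f (Γ₁.src e)) → χ (f (Γ₁.tgt e)))
    (hcomp : ∀ Z : H₂, ∀ w ∈ Z.1.verts, ∃ y ∈ (a.symm Z).1.verts,
      ∀ χ : V₂ → Prop, (∀ e ∈ Z.1.edges, (χ (Γ₂.src e) ↔ χ (Γ₂.tgt e))) → χ (f y) → χ w)
    (h : Γ₁.CoarselyCHomPRel H₁) : Γ₂.CoarselyCHomPRel H₂ := by
  classical
  obtain ⟨ε, -, h⟩ := h
  rw [cHomP_coneOff_iff] at h
  obtain ⟨K, hK⟩ := exists_nat_ge ε
  -- `R` bounds the distance between the `φ`-images of the ends of an edge. `M` bounds all loops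
  -- used below: images of loops of length at most `K`, and quadrilaterals of length at most `N * R
  -- + 2 * N + 1`.
  let R : ℕ := N * (N + N + 1) + N
  let M : ℕ := N * K + N * R + 2 * N + 2
  refine ⟨M, by positivity, (cHomP_coneOff_iff _ _).mpr fun z c hzc hz hc => ?_⟩
  have hloop : ∀ v p, Γ₂.IsPath v p v → p.length ≤ M → pathSum z p = 0 :=
    fun v p hp hl => hzc.loop v p hp (by exact_mod_cast hl)
  -- A primitive of `z` based at `u`, valid only near `u` (see `hγe`).
  let γ : V₂ → V₂ → ZMod 2 := fun u v => pathSum z (geodesic h₂ u v)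
  -- Extension by zero, so that predicates on all vertices can mention `c`; the value off `Z` plays
  -- no role.
  let c' : H₂ → V₂ → ZMod 2 := fun Z v => if hv : v ∈ Z.1.verts then c ⟨Z, v, hv⟩ else 0
  have hc' : ∀ (Z : H₂) (v) (hv : v ∈ Z.1.verts), c' Z v = c ⟨Z, v, hv⟩ :=
    fun Z v hv => dif_pos hv
  have htri : ∀ (Z : H₂) e, e ∈ Z.1.edges → z e = c' Z (Γ₂.src e) + c' Z (Γ₂.tgt e) := by
    intro Z e he
    rw [hzc.triangle Z e he, hc', hc']
  have hγ0 : ∀ u, γ u u = 0 := fun u =>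
    hloop u _ (isPath_geodesic h₂ u u) (by simp [length_geodesic])
  have hγe : ∀ u e, Γ₂.adjGraph.dist u (Γ₂.src e) ≤ N → Γ₂.adjGraph.dist u (Γ₂.tgt e) ≤ N →
      γ u (Γ₂.tgt e) = γ u (Γ₂.src e) + z e := by
    intro u e hs ht
    have := pathSum_eq_of_isPath hloop (isPath_geodesic h₂ u (Γ₂.tgt e))
      ((isPath_geodesic h₂ u (Γ₂.src e)).append (isPath_edge e)) (by
        simp only [List.length_append, length_geodesic, List.length_cons, List.length_nil]
        dsimp only [M]
        omega)
    simpa using this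
  have key := h (pullback Γ₁ h₂ f z)
    (fun x => c ⟨a x.1, f x.2, hmem x.1 x.2 x.2.2⟩) ?_
    (finite_support_pullback h₁ hfin₁ h₂ hup hlow hz) ?_
  · obtain ⟨g, k, hg, hk⟩ := key
    have hgγ : ∀ u v, Γ₁.adjGraph.dist u v ≤ R → ∃ q, Γ₂.IsPath (f u) q (f v) ∧
        q.length ≤ N * R ∧ pathSum z q = g u + g v := by
      intro u v huv
      obtain ⟨q, hq, hl, hs⟩ := exists_image_path h₂ hup z (isPath_geodesic h₁ u v)
      rw [length_geodesic] at hl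
      refine ⟨q, hq, hl.trans (Nat.mul_le_mul_left _ huv), ?_⟩
      rw [hs, pathSum_coboundary g hg (isPath_geodesic h₁ u v)]
    -- The value of `g` at the quasi-preimage of `w`, corrected by integrating `z` over the short
    -- way back to `w`.
    let g' : V₂ → ZMod 2 := fun w => g (φ w) + γ (f (φ w)) w
    have hg' : ∀ e, g' (Γ₂.tgt e) - g' (Γ₂.src e) = z e := by
      intro e
      have hs := hφ (Γ₂.src e)
      have ht := hφ (Γ₂.tgt e)
      have he := Γ₂.dist_src_tgt_le e
      obtain ⟨q, hq, hl, hsum⟩ := hgγ (φ (Γ₂.src e)) (φ (Γ₂.tgt e)) (by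
        refine (hlow _ _).trans (Nat.add_le_add_right (Nat.mul_le_mul_left _ ?_) _)
        have t1 := SimpleGraph.Connected.dist_triangle h₂ (u := f (φ (Γ₂.src e)))
          (v := Γ₂.src e) (w := f (φ (Γ₂.tgt e)))
        have t2 := SimpleGraph.Connected.dist_triangle h₂ (u := Γ₂.src e)
          (v := Γ₂.tgt e) (w := f (φ (Γ₂.tgt e)))
        rw [SimpleGraph.dist_comm (u := Γ₂.tgt e)] at t2
        omega)
      have := pathSum_eq_of_isPath hloop (hq.append (isPath_geodesic h₂ _ (Γ₂.tgt e)))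
        ((isPath_geodesic h₂ _ (Γ₂.src e)).append (isPath_edge e)) (by
          simp only [List.length_append, length_geodesic, List.length_cons, List.length_nil]
          dsimp only [M]
          omega)
      simp only [pathSum_append, hsum, pathSum_cons, pathSum_nil, add_zero] at this
      change g (φ (Γ₂.tgt e)) + pathSum z _ - (g (φ (Γ₂.src e)) + pathSum z _) = z e
      revert this
      generalize g (φ (Γ₂.tgt e)) = x1, g (φ (Γ₂.src e)) = x2, z e = x3,
        pathSum z (geodesic h₂ (f (φ (Γ₂.tgt e))) (Γ₂.tgt e)) = x4,
        pathSum z (geodesic h₂ (f (φ (Γ₂.src e))) (Γ₂.src e)) = x5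
      revert x1 x2 x3 x4 x5
      decide
    -- `φ (f y)` need not be `y`, but it lies within `R` of `y`, so the resulting loop is still
    -- filled.
    have hg'f : ∀ y, g' (f y) = g y := by
      intro y
      have hy := hφ (f y)
      obtain ⟨q, hq, hl, hsum⟩ := hgγ (φ (f y)) y (by
        refine (hlow _ _).trans (Nat.add_le_add_right (Nat.mul_le_mul_left _ ?_) _)
        omega)
      have := pathSum_eq_of_isPath hloop hq (isPath_geodesic h₂ _ (f y)) (by
          simp only [length_geodesic]
          dsimp only [M]
          omega)
      change g (φ (f y)) + pathSum z _ = g y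
      rw [← this, hsum, ← add_assoc, CharTwo.add_self_eq_zero, zero_add]
    refine ⟨g', fun Z => k (a.symm Z), hg', ?_⟩
    rintro Z ⟨w, hw⟩
    rw [← hc' Z w hw]
    obtain ⟨y, hy, hχ⟩ := hcomp Z w hw
    -- Both `c' Z` and `g'` change by `z` along an edge of `Z`, so the equation propagates from `f
    -- y` to `w`.
    refine hχ (fun w => k (a.symm Z) - g' w = c' Z w) ?_ ?_
    · intro e he
      have h1 := htri Z e he
      have h2 := hg' e
      rw [h1] at h2
      revert h2
      generalize g' (Γ₂.src e) = x1, g' (Γ₂.tgt e) = x2, c' Z (Γ₂.src e) = x3,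
        c' Z (Γ₂.tgt e) = x4, k (a.symm Z) = x5
      revert x1 x2 x3 x4 x5
      decide
    · have h1 := hk (a.symm Z) ⟨y, hy⟩
      have h2 := hmem _ y hy
      change k (a.symm Z) - g' (f y) = c' Z (f y)
      rw [hg'f, h1, ← hc' _ _ h2, a.apply_symm_apply]
  · refine ⟨fun v p hp hl => ?_, fun Y e he => ?_⟩
    · obtain ⟨q, hq, hql, hs⟩ := exists_image_path h₂ hup z hp
      rw [← hs]
      refine hloop _ q hq (hql.trans ?_)
      have : p.length ≤ K := by exact_mod_cast hl.trans hK
      exact (Nat.mul_le_mul_left N this).trans (by dsimp only [M]; omega)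
    · obtain ⟨W, hWe, hWv, hχ⟩ := hedge Y e he
      -- Near `f (Γ₁.src e)`, both `γ` and `c'` have coboundary `z` on `W`, so their sum is constant
      -- along its edges. Comparing its values at the two ends gives the triangle relation.
      have key := hχ (fun v => γ (f (Γ₁.src e)) v + c' (a Y) v = c' (a Y) (f (Γ₁.src e))) ?_ ?_
      · rw [← hc', ← hc']
        change γ (f (Γ₁.src e)) (f (Γ₁.tgt e)) = _
        rw [← key, add_assoc, CharTwo.add_self_eq_zero, add_zero]
      · intro e' he'
        have h1 := htri (a Y) e' (hWe he')
        rw [hγe _ e' (hWv _ (W.src_mem e' he')) (hWv _ (W.tgt_mem e' he')), h1]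
        generalize γ (f (Γ₁.src e)) (Γ₂.src e') = x1, c' (a Y) (Γ₂.src e') = x2,
          c' (a Y) (Γ₂.tgt e') = x3, c' (a Y) (f (Γ₁.src e)) = x4
        revert x1 x2 x3 x4
        decide
      · simp [hγ0]
  -- `a` is injective and `f` is finite-to-one, so only finitely many cone edges lie over each cone
  -- edge in the support of `c`.
  · have hfib : ∀ w, {u | f u = w}.Finite := fun w =>
      (finite_preimage_ball h₁ hfin₁ h₂ hlow w 0).subset fun u hu => by
        simp [show f u = w from hu]
    refine Set.Finite.of_finite_fibers
      (fun x : Σ Y : H₁, Y.1.verts => (⟨a x.1, f x.2, hmem x.1 x.2 x.2.2⟩ : Σ Z : H₂, Z.1.verts))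
      (hc.subset ?_) ?_
    · rintro _ ⟨x, hx, rfl⟩
      exact hx
    · rintro ⟨Z, w, hw⟩ -
      refine Set.Finite.subset (s := {x : Σ Y : H₁, Y.1.verts | x.1 = a.symm Z ∧ f x.2 = w}) ?_ ?_
      · refine Set.Finite.of_finite_image (f := fun x => x.2.1)
          ((hfib w).subset ?_) ?_
        · rintro _ ⟨x, hx, rfl⟩
          exact hx.2
        · rintro ⟨Y, v, hv⟩ ⟨hY, -⟩ ⟨Y', v', hv'⟩ ⟨hY', -⟩ hvv
          dsimp only at hY hY' hvv
          subst hY hY' hvv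
          rfl
      · rintro ⟨Y, v, hv⟩ ⟨-, hx⟩
        have h1 := congrArg Sigma.fst hx
        dsimp only at h1
        subst h1
        refine ⟨(a.symm_apply_apply Y).symm, ?_⟩
        have h2 := eq_of_heq (Sigma.mk.inj hx).2
        exact congrArg Subtype.val h2

end Transfer

end CWGraph

/-! ### From a continuous quasi-isometry to a map of vertices -/

open CWGraph in
theorem mainTheorem7 {V₁ E₁ V₂ E₂ : Type*}
    (Γ₁ : CWGraph V₁ E₁) (Γ₂ : CWGraph V₂ E₂)
    (hconn₁ : Γ₁.IsConnected) (hconn₂ : Γ₂.IsConnected)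
    (hfin₁ : Γ₁.IsLocallyFinite) (hfin₂ : Γ₂.IsLocallyFinite)
    (H₁ : Set Γ₁.Subgraph) (H₂ : Set Γ₂.Subgraph)
    (hH₁ : CWGraph.IsLocallyFiniteSystem H₁) (hH₂ : CWGraph.IsLocallyFiniteSystem H₂)
    (lam : ℝ) (hlam : 1 ≤ lam)
    (ψ : Γ₁.Point → Γ₂.Point) (hψ_cont : Continuous ψ) (hψ : IsQuasiIsometry lam lam ψ)
    (a : H₁ ≃ H₂)
    (ha : ∀ Y : H₁, ψ '' Y.1.carrier ⊆ (a Y).1.carrier)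
    (hcomp : ∀ Z : H₂, ∀ x ∈ Z.1.carrier,
      (connectedComponentIn Z.1.carrier x ∩ ψ '' (a.symm Z).1.carrier).Nonempty)
    (r : ℝ) (hr : 0 ≤ r)
    (hdist : ∀ Y : H₁,
      hausdorffDistance (a Y).1.carrier (ψ '' Y.1.carrier) ≤ ENNReal.ofReal r)
    (hchomp : Γ₁.CoarselyCHomPRel H₁) :
    Γ₂.CoarselyCHomPRel H₂ := by
  obtain ⟨n, hn⟩ := exists_nat_ge lam
  -- The linear terms absorb the upper bounds and the errors made by passing to roots; the square
  -- comes from inverting the lower bound.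
  let N : ℕ := n * n + 7 * n + 7
  have hN : (N : ℝ) = n * n + 7 * n + 7 := by simp [N]
  have hn0 : (1 : ℝ) ≤ n := hlam.trans hn
  have hN2 : 7 * lam + 7 ≤ N := by nlinarith
  -- `ψ` may send a vertex into an open edge, so its image is moved to the root.
  let f : V₁ → V₂ := fun v => (ψ (.vertex v)).root
  have hroot : ∀ (x y : Γ₁.Point), (Γ₂.adjGraph.dist (ψ x).root (ψ y).root : ℝ) ≤
      lam * (Γ₁.adjGraph.dist x.root y.root + 2) + lam + 2 := by
    intro x y
    have h1 := dist_root_le_dist hconn₂ (ψ x) (ψ y)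
    have h2 := hψ.upper x y
    have h3 := mul_le_mul_of_nonneg_left (dist_le_dist_root x y) (by linarith : 0 ≤ lam)
    linarith
  have hφ : ∀ w, ∃ v, Γ₂.adjGraph.dist (f v) w ≤ N := by
    intro w
    obtain ⟨_, ⟨x, rfl⟩, hx⟩ := exists_dist_lt_of_hausdorffDistance_le hψ.coarselySurjective
      (by linarith : 0 < lam + 1) (by linarith) (Set.mem_univ (Point.vertex w))
    refine ⟨x.root, ?_⟩
    have h1 := dist_root_le_dist hconn₂ (.vertex w) (ψ x)
    have h2 := hroot x (.vertex x.root)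
    have h3 := SimpleGraph.Connected.dist_triangle hconn₂ (u := w) (v := (ψ x).root)
      (w := f x.root)
    have h4 : (Γ₂.adjGraph.dist w (f x.root) : ℝ) ≤
        Γ₂.adjGraph.dist w (ψ x).root + Γ₂.adjGraph.dist (ψ x).root (f x.root) := by
      exact_mod_cast h3
    rw [SimpleGraph.dist_comm]
    simp only [root_vertex, SimpleGraph.dist_self, Nat.cast_zero] at h1 h2
    have h5 : (Γ₂.adjGraph.dist w (f x.root) : ℝ) ≤ N := by
      simp only [f] at h4 ⊢
      linarith
    exact_mod_cast h5
  choose φ hφ using hφ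
  have hclosed : ∀ e, IsPreconnected (Set.range fun t => ψ (Γ₁.edgeMap e t)) := fun e =>
    isPreconnected_range (hψ_cont.comp (continuous_edgeMap e))
  have hsrc : ∀ e, ψ (.vertex (Γ₁.src e)) ∈ Set.range fun t => ψ (Γ₁.edgeMap e t) :=
    fun e => ⟨0, by simp [edgeMap]⟩
  have htgt : ∀ e, ψ (.vertex (Γ₁.tgt e)) ∈ Set.range fun t => ψ (Γ₁.edgeMap e t) :=
    fun e => ⟨1, by simp [edgeMap]⟩
  have hsub : ∀ (Y : H₁) e, e ∈ Y.1.edges →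
      (Set.range fun t => ψ (Γ₁.edgeMap e t)) ⊆ (a Y).1.carrier := by
    rintro Y e he _ ⟨t, rfl⟩
    refine ha Y ⟨_, ?_, rfl⟩
    simp only [edgeMap]
    split_ifs
    · exact Y.1.src_mem e he
    · exact Y.1.tgt_mem e he
    · exact he
  refine CoarselyCHomPRel.transfer hconn₁ hfin₁ hconn₂ a f φ N ?_ ?_ hφ ?_ ?_ ?_ hchomp
  · intro e
    have h1 := hroot (.vertex (Γ₁.src e)) (.vertex (Γ₁.tgt e))
    have h2 : (Γ₁.adjGraph.dist (Γ₁.src e) (Γ₁.tgt e) : ℝ) ≤ 1 := by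
      exact_mod_cast Γ₁.dist_src_tgt_le e
    simp only [root_vertex] at h1
    have h3 : (Γ₂.adjGraph.dist (f (Γ₁.src e)) (f (Γ₁.tgt e)) : ℝ) ≤ N := by
      simp only [f]
      nlinarith
    exact_mod_cast h3
  · intro u v
    have h1 := dist_root_le_dist hconn₁ (.vertex u) (.vertex v)
    have h2 := hψ.lower (.vertex u) (.vertex v)
    have h3 := dist_le_dist_root (ψ (.vertex u)) (ψ (.vertex v))
    have h4 : dist (Point.vertex (G := Γ₁) u) (.vertex v) ≤
        lam * (Γ₂.adjGraph.dist (f u) (f v) + 2 + lam) := by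
      rw [one_div, ← sub_nonneg] at h2
      have h5 : lam⁻¹ * dist (Point.vertex (G := Γ₁) u) (.vertex v) ≤
        Γ₂.adjGraph.dist (f u) (f v) + 2 + lam := by
        simp only [f]
        linarith
      rwa [inv_mul_le_iff₀ (by linarith)] at h5
    have h6 : (0 : ℝ) ≤ Γ₂.adjGraph.dist (f u) (f v) := Nat.cast_nonneg _
    have h7 : lam * (Γ₂.adjGraph.dist (f u) (f v) + 2 + lam) ≤
        n * (Γ₂.adjGraph.dist (f u) (f v) + 2 + n) := by
      gcongr
    have h8 : (n : ℝ) * Γ₂.adjGraph.dist (f u) (f v) ≤ N * Γ₂.adjGraph.dist (f u) (f v) := by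
      refine mul_le_mul_of_nonneg_right ?_ h6
      nlinarith
    have h9 : (Γ₁.adjGraph.dist u v : ℝ) ≤ N * Γ₂.adjGraph.dist (f u) (f v) + N := by
      simp only [root_vertex] at h1
      nlinarith
    exact_mod_cast h9
  · intro Y v hv
    exact Subgraph.root_mem (ha Y ⟨.vertex v, hv, rfl⟩)
  · intro Y e he
    -- The hull of the image of one edge, rather than all of `a Y`, keeps the vertices within the
    -- range where local integration is path-independent.
    refine ⟨hull (Set.range fun t => ψ (Γ₁.edgeMap e t)), ?_, ?_, ?_⟩
    · rintro e' ⟨t, ht⟩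
      exact hsub Y e he ht
    -- The spare `1` pays for the far end of an open edge met by the image.
    · have key : ∀ q ∈ Set.range fun t => ψ (Γ₁.edgeMap e t),
          (Γ₂.adjGraph.dist (f (Γ₁.src e)) q.root : ℝ) + 1 ≤ N := by
        rintro _ ⟨t, rfl⟩
        have h1 := hroot (.vertex (Γ₁.src e)) (Γ₁.edgeMap e t)
        have h2 : (Γ₁.adjGraph.dist (Γ₁.src e) (Γ₁.edgeMap e t).root : ℝ) ≤ 1 := by
          simp only [edgeMap]
          split_ifs
          · simp
          · exact_mod_cast Γ₁.dist_src_tgt_le e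
          · simp
        simp only [root_vertex, f] at h1 h2 ⊢
        nlinarith
      rintro v (hv | ⟨e', t, ht, hv⟩)
      · have h1 := key _ hv
        have h2 : Γ₂.adjGraph.dist (f (Γ₁.src e)) v + 1 ≤ N := by exact_mod_cast h1
        omega
      · have h1 : Γ₂.adjGraph.dist (f (Γ₁.src e)) (Γ₂.src e') + 1 ≤ N := by
          exact_mod_cast key _ ht
        rcases hv with rfl | rfl
        · omega
        · have h2 := Γ₂.dist_src_tgt_le e'
          have h3 := SimpleGraph.Connected.dist_triangle hconn₂ (u := f (Γ₁.src e))
            (v := Γ₂.src e') (w := Γ₂.tgt e')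
          omega
    · intro χ hχ h
      exact Subgraph.root_iff_of_isPreconnected _ (hclosed e) (subset_carrier_hull _) χ hχ
        (hsrc e) (htgt e) h
  · intro Z w hw
    have hwZ : Point.vertex w ∈ Z.1.carrier := hw
    obtain ⟨_, hx, ⟨y, hy, rfl⟩⟩ := hcomp Z (.vertex w) hwZ
    refine ⟨y.root, Subgraph.root_mem hy, fun χ hχ h => ?_⟩
    -- If `y` lies in an open edge, the image of that edge is connected and lies in `Z`, so `χ`
    -- passes from the image of its source to `ψ y`.
    have h1 : χ (ψ y).root := by
      cases y with
      | vertex v => exact h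
      | inner e t =>
        refine Subgraph.root_iff_of_isPreconnected Z.1 (hclosed e) ?_ χ hχ (hsrc e)
          ⟨⟨t, t.2.1.le, t.2.2.le⟩, by simp [edgeMap, t.2.1.ne', t.2.2.ne]⟩ h
        have := hsub (a.symm Z) e hy
        rwa [a.apply_symm_apply] at this
    exact Subgraph.root_iff_of_isPreconnected Z.1 isPreconnected_connectedComponentIn
      (connectedComponentIn_subset _ _) χ hχ hx (mem_connectedComponentIn hwZ) h1
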